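/- For $p\in[0,1]$ let $\nu_p$ be the $p$-biased distribution on $\{0,1\}$, $\nu_p(1)=p$, $\nu_p(0)=1-p$. For a finite set $D$ and a probability distribution $\nu$ on $D$, a probability distribution $\mu$ on $D^k$ is pairwise $\nu$-independent if for every $2$-element set $T\subseteq[k]$ the marginal of $\mu$ on $D^T$ is the product distribution $\nu^T$. A relation $R\subseteq D^k$ supports a pairwise $\nu$-independent distribution if some pairwise $\nu$-independent probability distribution $\mu$ on $D^k$ satisfies $\operatorname{supp}(\mu)\subseteq R$. For a nonempty subdomain $S\subseteq D$, $R$ supports a pairwise uniform distribution over $S$ if there is a probability distribution supported on $R\cap S^k$ all of whose marginals on pairs of coordinates are uniform on $S^2$ (the case $S=D$ is the usual notion of supporting a pairwise uniform distribution). **Theorem.** Fix $0<p<1/16$. There is a constant $C=C(p)>0$ such that the following holds for every function $s=s(k)$ with $s(k)=\Theta(k^2)$ as $k\to\infty$. Let $R\subseteq\{0,1\}^k$ be the set of the strings obtained by drawing $s(k)$ strings independently, with replacement, from $\nu_p^k$. 1. If $s(k)\ge C k^2$ for all sufficiently large $k$, then with probability $1-o_k(1)$ both of the following hold: $R$ supports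 a pairwise $\nu_p$-independent distribution, and for no nonempty $S\subseteq\{0,1\}$ does $R$ support a pairwise uniform distribution over $S$. 2. Even without the assumption $s(k)\ge Ck^2$, with probability $1-o_k(1)$, for no nonempty $S\subseteq\{0,1\}$ does $R$ support a pairwise uniform distribution over $S$. -/

import Mathlib

open MeasureTheory ProbabilityTheory Filter Topology Asymptotics

/-- A distribution `μ` over `D ^ k` is `t`-wise `ν`-independent if its marginal on every set `T` of
`t` coordinates is the product distribution `ν ^ T`. -/
def TWiseIndependent {D : Type*} [MeasurableSpace D] {k : ℕ} (t : ℕ) (ν : Measure D)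
    (μ : Measure (Fin k → D)) : Prop :=
  ∀ T : Finset (Fin k), T.card = t → μ.map T.restrict = Measure.pi (fun _ : T => ν)

/-- The relation `R ⊆ D ^ k` supports a `t`-wise `ν`-independent distribution: there is such a
probability distribution on `D ^ k` all of whose atoms lie in `R` (`D` is a finite set). -/
def SupportsTWiseIndependent {D : Type*} [Fintype D] [MeasurableSpace D]
    [MeasurableSingletonClass D] {k : ℕ} (t : ℕ) (ν : Measure D) (R : Set (Fin k → D)) : Prop :=
  ∃ μ : Measure (Fin k → D), IsProbabilityMeasure μ ∧ TWiseIndependent t ν μ ∧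
    ∀ a : Fin k → D, μ {a} ≠ 0 → a ∈ R

/-- The restriction of the relation `R ⊆ D ^ k` to the subdomain `S ⊆ D`, that is `R ∩ S ^ k`. -/
def restrictToSubdomain {D : Type*} {k : ℕ} (S : Set D) (R : Set (Fin k → D)) :
    Set (Fin k → D) :=
  {a | a ∈ R ∧ ∀ i, a i ∈ S}

/-- `R`, restricted to the subdomain `S`, supports a `t`-wise uniform distribution over `S`: a
distribution on `R ∩ S ^ k` all of whose `t`-wise marginals are uniform on `S ^ t`. -/
def SupportsTWiseUniformOn {D : Type*} [Fintype D] [MeasurableSpace D]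
    [MeasurableSingletonClass D] {k : ℕ} (t : ℕ) (S : Set D) (R : Set (Fin k → D)) : Prop :=
  SupportsTWiseIndependent t (uniformOn S) (restrictToSubdomain S R)

/-- The `p`-biased distribution `ν_p` on `{0, 1}`: mass `p` at `1` and mass `1 - p` at `0`. -/
noncomputable def biased (p : unitInterval) : Measure (Fin 2) :=
  bernoulliMeasure 1 0 p

/-- The law of `s` independent strings in `{0, 1} ^ k`, each drawn from `ν_p ^ k`. -/
noncomputable def randomStrings (p : unitInterval) (k s : ℕ) :
    Measure (Fin s → Fin k → Fin 2) :=
  Measure.pi (fun _ => Measure.pi (fun _ => biased p))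

/-!
A quadratic polynomial in independent biased bits cannot be positive too often if its mean is zero:
Bonami's lemma (`integral_pow_four_le`) bounds its fourth moment by a multiple of its squared
variance, so by Cauchy-Schwarz it is nonpositive with probability at least some `c` depending only
on `p` (`one_le_four_mul_measureReal_nonpos`).

A relation supports a pairwise `ν_p`-independent distribution as soon as the origin lies in the
convex hull of the vectors of centered pair indicators of its strings (`pairFeature`), whose linear
functionals are exactly such mean-zero quadratic polynomials. If the origin is not in the hull of
the sample vectors, the minimal norm point `w` of the hull has positive inner product with all of
them. By Carathéodory's theorem `w` is already the minimal norm point of the hull of a subfamily of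
size at most `n = O(k ^ 2)`. For a fixed subfamily, the remaining samples are independent of its
minimal norm point, and each of them has positive inner product with that point with probability at
most `1 - c`. A union bound over all small subfamilies gives the failure probability
`(2 / c) ^ n * (1 - c / 2) ^ s` (`measureReal_zero_notMem_convexHull_le`), which is tiny if `s` is a
large multiple of `k ^ 2`.

In the other direction, a relation supporting a pairwise uniform distribution over a nonempty
subdomain contains the zero string or a string at least half of whose entries are `1`
(`exists_mem_of_supportsTWiseUniformOn`). A random string is of one of these kinds with
exponentially small probability, and there are only `O(k ^ 2)` of them.
-/

instance isProbabilityMeasure_biased (p : unitInterval) : IsProbabilityMeasure (biased p) :=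
  inferInstanceAs (IsProbabilityMeasure (bernoulliMeasure (1 : Fin 2) 0 p))

instance isProbabilityMeasure_randomStrings (p : unitInterval) (k s : ℕ) :
    IsProbabilityMeasure (randomStrings p k s) := by
  unfold randomStrings; infer_instance

/-! ### Anti-concentration from a fourth moment bound -/

section AntiConcentration

variable {Ω : Type*} [Fintype Ω] [MeasurableSpace Ω] [MeasurableSingletonClass Ω]

theorem sq_integral_mul_le (μ : Measure Ω) [IsFiniteMeasure μ] (f g : Ω → ℝ) :
    (∫ x, f x * g x ∂μ) ^ 2 ≤ (∫ x, f x ^ 2 ∂μ) * ∫ x, g x ^ 2 ∂μ := by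
  simp only [integral_fintype .of_finite, smul_eq_mul]
  refine Finset.sum_sq_le_sum_mul_sum_of_sq_le_mul _ (fun i _ => by positivity)
    (fun i _ => by positivity) fun i _ => le_of_eq (by ring)

/-- A mean-zero function whose fourth moment is controlled by its variance is nonpositive with
probability bounded below. -/
theorem one_le_four_mul_measureReal_nonpos (μ : Measure Ω) [IsProbabilityMeasure μ] {f : Ω → ℝ}
    {M : ℝ} (hM : 1 ≤ M) (hf : ∫ x, f x ∂μ = 0)
    (h4 : ∫ x, f x ^ 4 ∂μ ≤ M * (∫ x, f x ^ 2 ∂μ) ^ 2) :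
    1 ≤ 4 * M * μ.real {x | f x ≤ 0} := by
  have hint (g : Ω → ℝ) : Integrable g μ := .of_finite
  set A := ∫ x, f x ^ 2 ∂μ with hA
  set F := ∫ x, f x ^ 4 ∂μ with hF
  set P := μ.real {x | f x ≤ 0} with hP
  have hA0 : 0 ≤ A := integral_nonneg fun x => by positivity
  have hF0 : 0 ≤ F := integral_nonneg fun x => by positivity
  have hP0 : 0 ≤ P := measureReal_nonneg
  rcases hA0.eq_or_lt with h0 | hpos
  · have hae : (fun x => f x ^ 2) =ᵐ[μ] 0 :=
      (integral_eq_zero_iff_of_nonneg (fun x => by positivity) (hint _)).1 h0.symm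
    have h1 : P = 1 := by
      rw [hP, measureReal_def, (prob_compl_eq_zero_iff (Set.toFinite _).measurableSet).1,
        ENNReal.toReal_one]
      refine measure_mono_null (fun x hx => ?_) (ae_iff.1 hae)
      simp only [Set.mem_compl_iff, Set.mem_ofPred_eq, not_le, Pi.zero_apply] at hx ⊢
      positivity
    rw [h1]; linarith
  · set N := ∫ x, |f x| ∂μ with hN
    set T := ∫ x, |f x| ^ 3 ∂μ with hT
    have hN0 : 0 ≤ N := integral_nonneg fun x => by positivity
    have hT0 : 0 ≤ T := integral_nonneg fun x => by positivity
    have e1 : A ^ 2 ≤ N * T := by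
      have := sq_integral_mul_le μ (fun x => √|f x|) (fun x => |f x| * √|f x|)
      have h (x : Ω) : √|f x| * √|f x| = |f x| := Real.mul_self_sqrt (abs_nonneg _)
      have h1 (x : Ω) : √|f x| * (|f x| * √|f x|) = f x ^ 2 := by
        rw [mul_left_comm, h, ← sq, sq_abs]
      have h2 (x : Ω) : √|f x| ^ 2 = |f x| := by rw [sq, h]
      have h3 (x : Ω) : (|f x| * √|f x|) ^ 2 = |f x| ^ 3 := by rw [mul_pow, h2]; ring
      simpa only [h1, h2, h3] using this
    have e2 : T ^ 2 ≤ A * F := by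
      have := sq_integral_mul_le μ (fun x => |f x|) (fun x => |f x| ^ 2)
      have h1 (x : Ω) : |f x| * |f x| ^ 2 = |f x| ^ 3 := by ring
      have h2 (x : Ω) : (|f x| ^ 2) ^ 2 = f x ^ 4 := by rw [sq_abs]; ring
      simp only [h1, h2] at this
      simpa only [sq_abs] using this
    have e3 : N ^ 2 ≤ 4 * (A * P) := by
      -- As `f` has mean zero, its negative part carries half of `∫ |f|`.
      have hN2 : N = (∫ x, f x ∂μ) + -2 * ∫ x, f x * Set.indicator {x | f x ≤ 0} 1 x ∂μ := by
        rw [hN, ← integral_const_mul, ← integral_add (hint _) (hint _)]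
        refine integral_congr_ae (.of_forall fun x => ?_)
        rcases le_or_gt (f x) 0 with h | h
        · simp only [abs_of_nonpos h, Set.indicator, Set.mem_ofPred_eq, h, if_true, Pi.one_apply]
          ring
        · simp [abs_of_pos h, Set.indicator, h.not_ge]
      have := sq_integral_mul_le μ f (Set.indicator {x | f x ≤ 0} 1)
      have h2 : ∫ x, (Set.indicator {x | f x ≤ 0} 1 x : ℝ) ^ 2 ∂μ = P := by
        rw [hP, ← integral_indicator_one (Set.toFinite _).measurableSet]
        refine integral_congr_ae (.of_forall fun x => ?_)
        by_cases h : f x ≤ 0 <;> simp [h]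
      rw [h2] at this
      rw [hN2, hf, zero_add]; nlinarith
    have e4 : A ^ 4 ≤ 4 * (A * P) * (A * F) := calc
      A ^ 4 = (A ^ 2) ^ 2 := by ring
      _ ≤ (N * T) ^ 2 := by gcongr
      _ = N ^ 2 * T ^ 2 := by ring
      _ ≤ _ := by gcongr
    have e5 : A ^ 4 * 1 ≤ A ^ 4 * (4 * M * P) := calc
      A ^ 4 * 1 ≤ 4 * (A * P) * (A * F) := by rw [mul_one]; exact e4
      _ ≤ 4 * (A * P) * (A * (M * A ^ 2)) := by gcongr
      _ = _ := by ring
    exact le_of_mul_le_mul_left e5 (by positivity)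

end AntiConcentration

/-! ### Hypercontractivity for low-degree functions on the biased cube -/

/-- The function `f` on the cube `{0, 1} ^ n` is a polynomial of degree less than `d`. The recursion
is on the first coordinate: the restriction of `f` to `x₀ = 0` has degree less than `d`, and the
discrete derivative in direction `0` has degree less than `d - 1`. Degree less than `0` means that
`f` vanishes. -/
def HasDegreeLT : (n d : ℕ) → ((Fin n → Fin 2) → ℝ) → Prop
  | _, 0, f => f = 0
  | 0, _ + 1, _ => True
  | n + 1, d + 1, f => HasDegreeLT n (d + 1) (fun y => f (Fin.cons 0 y)) ∧
      HasDegreeLT n d (fun y => f (Fin.cons 1 y) - f (Fin.cons 0 y))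

namespace HasDegreeLT

theorem zero : ∀ n d : ℕ, HasDegreeLT n d 0
  | 0, 0 => by simp [HasDegreeLT]
  | n + 1, 0 => by simp [HasDegreeLT]
  | 0, d + 1 => by simp [HasDegreeLT]
  | n + 1, d + 1 => by
    refine ⟨zero n (d + 1), ?_⟩
    simpa [← Pi.zero_def] using zero n d

theorem add : ∀ {n d : ℕ} {f g : (Fin n → Fin 2) → ℝ}, HasDegreeLT n d f → HasDegreeLT n d g →
    HasDegreeLT n d (f + g)
  | 0, 0, f, g, hf, hg => by simp_all [HasDegreeLT]
  | n + 1, 0, f, g, hf, hg => by simp_all [HasDegreeLT]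
  | 0, d + 1, f, g, hf, hg => by simp [HasDegreeLT]
  | n + 1, d + 1, f, g, hf, hg => by
    refine ⟨hf.1.add hg.1, ?_⟩
    convert hf.2.add hg.2 using 1
    ext y
    simp only [Pi.add_apply]
    ring

theorem const_mul (c : ℝ) : ∀ {n d : ℕ} {f : (Fin n → Fin 2) → ℝ}, HasDegreeLT n d f →
    HasDegreeLT n d (fun x => c * f x)
  | 0, 0, f, hf => by simp_all [HasDegreeLT, Pi.zero_def]
  | n + 1, 0, f, hf => by simp_all [HasDegreeLT, Pi.zero_def]
  | 0, d + 1, f, hf => by simp [HasDegreeLT]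
  | n + 1, d + 1, f, hf => by
    refine ⟨hf.1.const_mul c, ?_⟩
    convert hf.2.const_mul c using 1
    ext y
    ring

theorem sum {ι : Type*} (s : Finset ι) {n d : ℕ} {f : ι → (Fin n → Fin 2) → ℝ}
    (hf : ∀ i ∈ s, HasDegreeLT n d (f i)) : HasDegreeLT n d (∑ i ∈ s, f i) :=
  Finset.sum_induction _ (HasDegreeLT n d) (fun _ _ => add) (zero n d) hf

theorem succ : ∀ {n d : ℕ} {f : (Fin n → Fin 2) → ℝ}, HasDegreeLT n d f →
    HasDegreeLT n (d + 1) f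
  | n, 0, f, hf => by
    have h0 : f = 0 := by cases n <;> simpa [HasDegreeLT] using hf
    rw [h0]; exact zero n 1
  | 0, d + 1, f, hf => by simp [HasDegreeLT]
  | n + 1, d + 1, f, hf => ⟨hf.1.succ, hf.2.succ⟩

theorem const (c : ℝ) (d : ℕ) : ∀ n : ℕ, HasDegreeLT n (d + 1) (fun _ => c)
  | 0 => by simp [HasDegreeLT]
  | n + 1 => ⟨const c d n, by simpa [← Pi.zero_def] using zero n d⟩

theorem of_apply (u : Fin 2 → ℝ) (d : ℕ) : ∀ {n : ℕ} (i : Fin n),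
    HasDegreeLT n (d + 2) (fun x => u (x i))
  | n + 1, i => by
    cases i using Fin.cases with
    | zero => exact ⟨by simpa using const _ _ n, by simpa using const _ d n⟩
    | succ i => exact ⟨by simpa using of_apply u d i, by simpa [← Pi.zero_def] using zero n _⟩

/-- A function of two coordinates is a polynomial of degree at most two. -/
theorem of_apply_apply (u : Fin 2 → Fin 2 → ℝ) : ∀ {n : ℕ} (i j : Fin n),
    HasDegreeLT n 3 (fun x => u (x i) (x j))
  | n + 1, i, j => by
    cases i using Fin.cases with
    | zero =>
      cases j using Fin.cases with
      | zero => exact ⟨by simpa using const _ _ n, by simpa using const _ 1 n⟩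
      | succ j =>
        exact ⟨by simpa using of_apply (u 0) 1 j,
          by simpa using of_apply (fun b => u 1 b - u 0 b) 0 j⟩
    | succ i =>
      cases j using Fin.cases with
      | zero =>
        exact ⟨by simpa using of_apply (fun b => u b 0) 1 i,
          by simpa using of_apply (fun b => u b 1 - u b 0) 0 i⟩
      | succ j =>
        exact ⟨by simpa using of_apply_apply u i j, by simpa [← Pi.zero_def] using zero n _⟩

end HasDegreeLT

theorem integral_pi_biased_succ (p : unitInterval) (n : ℕ) (f : (Fin (n + 1) → Fin 2) → ℝ) :
    ∫ x, f x ∂Measure.pi (fun _ => biased p) =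
      ∫ y, ((1 - p) * f (Fin.cons 0 y) + p * f (Fin.cons 1 y)) ∂Measure.pi (fun _ => biased p) := by
  have h := (measurePreserving_piFinSuccAbove (fun _ : Fin (n + 1) => biased p) 0).symm
  rw [← h.integral_comp (MeasurableEquiv.measurableEmbedding _),
    integral_prod_symm _ .of_finite]
  refine integral_congr_ae (.of_forall fun y => ?_)
  simp only [biased, integral_bernoulliMeasure, smul_eq_mul]
  rw [add_comm]
  simp [MeasurableEquiv.piFinSuccAbove, Fin.insertNthEquiv]

/-- **Bonami's lemma** for the biased cube, with an unoptimized constant: the fourth moment of a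
low-degree polynomial is bounded by a constant multiple of the square of its second moment. -/
theorem integral_pow_four_le (p : unitInterval) {L : ℝ} (hL : 4 ≤ L)
    (hp : 3 ≤ L ^ 2 * (p * (1 - p))) :
    ∀ {n d : ℕ} {f : (Fin n → Fin 2) → ℝ}, HasDegreeLT n d f →
      ∫ x, f x ^ 4 ∂Measure.pi (fun _ => biased p) ≤
        (L ^ 2) ^ d * (∫ x, f x ^ 2 ∂Measure.pi (fun _ => biased p)) ^ 2
  | n, 0, f, hf => by
    have h0 : f = 0 := by cases n <;> simpa [HasDegreeLT] using hf
    simp [h0]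
  | 0, d + 1, f, hf => by
    have h1 : ∀ g : (Fin 0 → Fin 2) → ℝ, ∫ x, g x ∂Measure.pi (fun _ => biased p) = g default := by
      intro g
      rw [integral_unique, probReal_univ, one_smul]
      exact congrArg g (Subsingleton.elim _ _)
    rw [h1, h1]
    have : 1 ≤ (L ^ 2) ^ (d + 1) := one_le_pow₀ (one_le_pow₀ (by linarith))
    nlinarith [show 0 ≤ f default ^ 4 by positivity]
  | n + 1, d + 1, f, hf => by
    have hint (g : (Fin n → Fin 2) → ℝ) : Integrable g (Measure.pi (fun _ => biased p)) :=
      .of_finite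
    set μ : Measure (Fin n → Fin 2) := Measure.pi (fun _ => biased p) with hμ
    set a : (Fin n → Fin 2) → ℝ := fun y => f (Fin.cons 1 y) - f (Fin.cons 0 y) with ha
    -- `b` is the average of `f` over the first coordinate, so that `f = b + (x₀ - p) a`.
    set b : (Fin n → Fin 2) → ℝ := (fun y => f (Fin.cons 0 y)) + (fun y => p * a y) with hb
    have hbd : HasDegreeLT n (d + 1) b := hf.1.add (hf.2.const_mul p).succ
    have IHa := integral_pow_four_le p hL hp hf.2
    have IHb := integral_pow_four_le p hL hp hbd
    have h0 (y) : f (Fin.cons 0 y) = b y - p * a y := by simp [hb]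
    have h1 (y) : f (Fin.cons 1 y) = b y + (1 - p) * a y := by simp [hb, ha]; ring
    set σ : ℝ := p * (1 - p) with hσ
    have hσ0 : 0 ≤ σ := mul_nonneg p.2.1 (sub_nonneg.2 p.2.2)
    have key : (∫ y, a y ^ 2 * b y ^ 2 ∂μ) ≤
        L * (L ^ 2) ^ d * ((∫ y, a y ^ 2 ∂μ) * ∫ y, b y ^ 2 ∂μ) := by
      have hA : 0 ≤ ∫ y, a y ^ 2 ∂μ := integral_nonneg fun x => by positivity
      have hB : 0 ≤ ∫ y, b y ^ 2 ∂μ := integral_nonneg fun x => by positivity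
      refine le_of_sq_le_sq ?_ (by positivity)
      refine (sq_integral_mul_le μ _ _).trans ?_
      have e (g : (Fin n → Fin 2) → ℝ) (y) : (g y ^ 2) ^ 2 = g y ^ 4 := by ring
      simp only [e]
      refine (mul_le_mul IHa IHb (integral_nonneg fun x => by positivity) (by positivity)).trans ?_
      exact le_of_eq (by ring)
    have h2 : ∫ x, f x ^ 2 ∂Measure.pi (fun _ => biased p) =
        (∫ y, b y ^ 2 ∂μ) + σ * ∫ y, a y ^ 2 ∂μ := by
      rw [integral_pi_biased_succ, ← integral_const_mul, ← integral_add (hint _) (hint _)]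
      refine integral_congr_ae (.of_forall fun y => ?_)
      simp only [h0, h1, hσ]
      ring
    have h4 : ∫ x, f x ^ 4 ∂Measure.pi (fun _ => biased p) ≤
        (∫ y, b y ^ 4 ∂μ) + 8 * σ * (∫ y, a y ^ 2 * b y ^ 2 ∂μ) + 3 * σ * ∫ y, a y ^ 4 ∂μ := by
      rw [integral_pi_biased_succ, ← integral_const_mul, ← integral_const_mul,
        ← integral_add (hint _) (hint _), ← integral_add (hint _) (hint _)]
      refine integral_mono (hint _) (hint _) fun y => ?_
      simp only [h0, h1]
      -- The difference of the two sides, as a sum of squares.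
      have : 0 ≤ 2 * σ * (a y * b y - (1 - 2 * p) * a y ^ 2) ^ 2 + 11 * σ ^ 2 * a y ^ 4 := by
        positivity
      rw [hσ] at this ⊢
      linear_combination this
    rw [h2]
    have hA : 0 ≤ ∫ y, a y ^ 2 ∂μ := integral_nonneg fun x => by positivity
    have hB : 0 ≤ ∫ y, b y ^ 2 ∂μ := integral_nonneg fun x => by positivity
    set A := ∫ y, a y ^ 2 ∂μ
    set B := ∫ y, b y ^ 2 ∂μ
    calc _ ≤ _ := h4
      _ ≤ (L ^ 2) ^ (d + 1) * B ^ 2 + 8 * σ * (L * (L ^ 2) ^ d * (A * B)) +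
          3 * σ * ((L ^ 2) ^ d * A ^ 2) := by gcongr
      _ = (L ^ 2) ^ d * (L ^ 2 * B ^ 2 + 4 * (2 * L * (σ * (A * B))) + 3 * (σ * A ^ 2)) := by ring
      _ ≤ (L ^ 2) ^ d * (L ^ 2 * B ^ 2 + L * (2 * L * (σ * (A * B))) +
          L ^ 2 * σ * (σ * A ^ 2)) := by gcongr
      _ = (L ^ 2) ^ (d + 1) * (B + σ * A) ^ 2 := by ring

/-! ### Random convex hulls containing the origin -/

section ConvexHull

variable {E : Type*} [NormedAddCommGroup E] [InnerProductSpace ℝ E]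

/-- The point `w` is the point of minimal norm of the convex set `K`, expressed by the variational
inequality. -/
def IsMinNormPoint (K : Set E) (w : E) : Prop :=
  w ∈ K ∧ ∀ z ∈ K, inner ℝ w w ≤ inner ℝ w z

theorem IsMinNormPoint.unique {K : Set E} {w w' : E} (h : IsMinNormPoint K w)
    (h' : IsMinNormPoint K w') : w = w' := by
  have h1 := h.2 w' h'.1
  have h2 := h'.2 w h.1
  rw [real_inner_comm] at h2
  have h3 : inner ℝ (w - w') (w - w') ≤ 0 := by
    rw [inner_sub_left, inner_sub_right, inner_sub_right, real_inner_comm w w']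
    rw [real_inner_comm w w'] at h2
    linarith
  by_contra h
  exact (real_inner_self_pos.2 (sub_ne_zero.2 h)).not_ge h3

theorem exists_isMinNormPoint [FiniteDimensional ℝ E] {ι : Type*} [Finite ι] [Nonempty ι]
    (v : ι → E) : ∃ w, IsMinNormPoint (convexHull ℝ (Set.range v)) w := by
  have hconv := convex_convexHull ℝ (Set.range v)
  obtain ⟨w, hw, hmin⟩ := exists_norm_eq_iInf_of_complete_convex
    ((Set.range_nonempty v).convexHull)
    ((Set.finite_range v).isCompact_convexHull ℝ).isClosed.isComplete hconv 0
  refine ⟨w, hw, fun z hz => ?_⟩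
  have := (norm_eq_iInf_iff_real_inner_le_zero hconv hw).1 hmin z hz
  rw [zero_sub, inner_neg_left, inner_sub_right] at this
  linarith

/-- If the origin is not in the convex hull of a finite family, then the minimal norm point of the
hull of some small subfamily has positive inner product with all members of the family. The
subfamily comes from Carathéodory's theorem, applied to the minimal norm point of the whole hull. -/
theorem exists_card_le_isMinNormPoint [FiniteDimensional ℝ E] {ι : Type*} [Finite ι] [Nonempty ι]
    (v : ι → E) (h0 : (0 : E) ∉ convexHull ℝ (Set.range v)) :
    ∃ I : Finset ι, I.card ≤ Module.finrank ℝ E + 1 ∧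
      ∃ w, IsMinNormPoint (convexHull ℝ (v '' I)) w ∧ ∀ i, 0 < inner ℝ w (v i) := by
  classical
  obtain ⟨w, hw, hmin⟩ := exists_isMinNormPoint v
  have hw0 : w ≠ 0 := fun h => h0 (h ▸ hw)
  have hw' := hw
  rw [convexHull_eq_union] at hw'
  simp only [Set.mem_iUnion] at hw'
  obtain ⟨t, hts, hind, hwt⟩ := hw'
  obtain ⟨I, hI, hIcard⟩ : ∃ I : Finset ι, v '' I = t ∧ I.card ≤ t.card := by
    have hex : ∀ y : t, ∃ i, v i = y := fun y => hts y.2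
    choose g hg using hex
    refine ⟨Finset.univ.image g, ?_, ?_⟩
    · ext y
      simp only [Finset.coe_image, Finset.coe_univ, Set.image_univ, Set.mem_image, Set.mem_range,
        exists_exists_eq_and, hg]
      simp
    · exact Finset.card_image_le.trans (by simp)
  refine ⟨I, hIcard.trans ?_, w, ⟨hI ▸ hwt, fun z hz => hmin z ?_⟩, fun i => ?_⟩
  · have := hind.card_le_finrank_succ
    rw [Fintype.card_coe] at this
    exact this.trans (by gcongr; exact Submodule.finrank_le _)
  · exact convexHull_mono (Set.image_subset_range _ _) hz
  · exact (real_inner_self_pos.2 hw0).trans_le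
      (hmin _ (subset_convexHull ℝ _ (Set.mem_range_self i)))

variable {Ω : Type*} [Fintype Ω] [MeasurableSpace Ω] [MeasurableSingletonClass Ω]

/-- For a fixed subfamily `I` of the samples, it is unlikely that all the other samples lie in the
open half-space determined by the minimal norm point of the hull of `I`, since they are independent
of `I`. -/
theorem measureReal_isMinNormPoint_le (μ : Measure Ω) [IsProbabilityMeasure μ] (v : Ω → E) {c : ℝ}
    (hc : ∀ w, c ≤ μ.real {a | inner ℝ w (v a) ≤ 0}) {ι : Type*} [Fintype ι] (I : Finset ι) :
    (Measure.pi fun _ : ι => μ).real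
      {x | ∃ w, IsMinNormPoint (convexHull ℝ ((fun i => v (x i)) '' I)) w ∧
        ∀ i, 0 < inner ℝ w (v (x i))} ≤ (1 - c) ^ (Fintype.card ι - I.card) := by
  classical
  have hc1 (w : E) : μ.real {a | 0 < inner ℝ w (v a)} ≤ 1 - c := by
    have := probReal_compl_eq_one_sub (μ := μ)
      (Set.toFinite {a | inner ℝ w (v a) ≤ 0}).measurableSet
    simp only [Set.compl_ofPred, not_le] at this
    rw [this]
    linarith [hc w]
  have hc0 : 0 ≤ 1 - c := measureReal_nonneg.trans (hc1 0)
  have h := measurePreserving_piEquivPiSubtypeProd (fun _ : ι => μ) (· ∈ I)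
  set S : Set (({i // i ∈ I} → Ω) × ({i // i ∉ I} → Ω)) :=
    {z | ∃ w, IsMinNormPoint (convexHull ℝ (Set.range fun i => v (z.1 i))) w ∧
      ∀ i, 0 < inner ℝ w (v (z.2 i))} with hS
  have hsub : {x : ι → Ω | ∃ w, IsMinNormPoint (convexHull ℝ ((fun i => v (x i)) '' I)) w ∧
        ∀ i, 0 < inner ℝ w (v (x i))} ⊆
      MeasurableEquiv.piEquivPiSubtypeProd (fun _ => Ω) (· ∈ I) ⁻¹' S := by
    rintro x ⟨w, hw, hpos⟩
    refine ⟨w, ?_, fun i => hpos i⟩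
    convert hw using 2
    ext y
    simp [MeasurableEquiv.piEquivPiSubtypeProd, Equiv.piEquivPiSubtypeProd]
  refine (measureReal_mono hsub).trans ?_
  rw [h.measureReal_preimage (Set.toFinite _).measurableSet.nullMeasurableSet]
  refine ENNReal.toReal_le_of_le_ofReal (by positivity) ?_
  rw [Measure.prod_apply (Set.toFinite _).measurableSet]
  have hslice (y : {i // i ∈ I} → Ω) :
      (Measure.pi fun _ : {i // i ∉ I} => μ) (Prod.mk y ⁻¹' S) ≤
        ENNReal.ofReal ((1 - c) ^ (Fintype.card ι - I.card)) := by
    by_cases hy : ∃ w, IsMinNormPoint (convexHull ℝ (Set.range fun i => v (y i))) w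
    · obtain ⟨w, hw⟩ := hy
      have hsub' : Prod.mk y ⁻¹' S ⊆ Set.univ.pi fun _ => {a | 0 < inner ℝ w (v a)} := by
        rintro z ⟨w', hw', hz⟩ i -
        rw [hw.unique hw']
        exact hz i
      refine (measure_mono hsub').trans ?_
      rw [Measure.pi_pi, Finset.prod_const, Finset.card_univ, Fintype.card_subtype_compl,
        Fintype.card_coe, ENNReal.ofReal_pow hc0]
      gcongr
      rw [← ofReal_measureReal]
      exact ENNReal.ofReal_le_ofReal (hc1 w)
    · have : Prod.mk y ⁻¹' S = ∅ := by
        ext z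
        simp only [Set.mem_preimage, Set.mem_empty_iff_false, iff_false]
        rintro ⟨w, hw, -⟩
        exact hy ⟨w, hw⟩
      simp [this]
  refine (lintegral_mono hslice).trans ?_
  simp

/-- If every closed half-space bounded by a hyperplane through the origin has probability at least
`c`, then the convex hull of independent samples fails to contain the origin with probability
exponentially small in the number of samples, as soon as this number exceeds a large multiple of the
dimension. -/
theorem measureReal_zero_notMem_convexHull_le [FiniteDimensional ℝ E] (μ : Measure Ω)
    [IsProbabilityMeasure μ] (v : Ω → E) {c : ℝ} (hc0 : 0 < c)
    (hc : ∀ w, c ≤ μ.real {a | inner ℝ w (v a) ≤ 0}) {ι : Type*} [Fintype ι] [Nonempty ι] {n : ℕ}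
    (hn : Module.finrank ℝ E + 1 ≤ n) :
    (Measure.pi fun _ : ι => μ).real
      {x | (0 : E) ∉ convexHull ℝ (Set.range fun i => v (x i))} ≤
      (2 / c) ^ n * (1 - c / 2) ^ Fintype.card ι := by
  classical
  have hc1 : c ≤ 1 := (hc 0).trans measureReal_le_one
  have hc2 : 0 ≤ 1 - c := by linarith
  have hsub : {x : ι → Ω | (0 : E) ∉ convexHull ℝ (Set.range fun i => v (x i))} ⊆
      ⋃ I ∈ Finset.univ.filter (fun I : Finset ι => I.card ≤ n),
        {x | ∃ w, IsMinNormPoint (convexHull ℝ ((fun i => v (x i)) '' I)) w ∧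
          ∀ i, 0 < inner ℝ w (v (x i))} := by
    intro x hx
    obtain ⟨I, hI, h⟩ := exists_card_le_isMinNormPoint (fun i => v (x i)) hx
    simp only [Set.mem_iUnion]
    exact ⟨I, by simpa using hI.trans hn, h⟩
  calc _ ≤ _ := measureReal_mono hsub (measure_ne_top _ _)
    _ ≤ ∑ I ∈ Finset.univ.filter (fun I : Finset ι => I.card ≤ n), _ :=
      measureReal_biUnion_finset_le _ _
    _ ≤ ∑ I ∈ Finset.univ.filter (fun I : Finset ι => I.card ≤ n),
        (2 / c) ^ n * ((c / 2) ^ I.card * (1 - c) ^ (Fintype.card ι - I.card)) := by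
      refine Finset.sum_le_sum fun I hI => (measureReal_isMinNormPoint_le μ v hc I).trans ?_
      have hI' : I.card ≤ n := by simpa using hI
      -- Weighting `I` by this factor turns the sum over all `I` into a binomial expansion.
      have h1 : 1 ≤ (2 / c) ^ n * (c / 2) ^ I.card := by
        rw [← Nat.sub_add_cancel hI', pow_add, mul_assoc, ← mul_pow]
        have : 2 / c * (c / 2) = 1 := by field_simp
        rw [this, one_pow, mul_one]
        exact one_le_pow₀ (by rw [le_div_iff₀ hc0]; linarith)
      rw [← mul_assoc]
      exact le_mul_of_one_le_left (by positivity) h1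
    _ ≤ ∑ I : Finset ι,
        (2 / c) ^ n * ((c / 2) ^ I.card * (1 - c) ^ (Fintype.card ι - I.card)) :=
      Finset.sum_le_sum_of_subset_of_nonneg (Finset.filter_subset _ _)
        fun I _ _ => by positivity
    _ = (2 / c) ^ n * (1 - c / 2) ^ Fintype.card ι := by
      rw [← Finset.mul_sum, Fintype.sum_pow_mul_eq_add_pow]
      congr 2
      ring

end ConvexHull

/-! ### Pairwise independence as a convex hull condition -/

theorem exists_weights_of_mem_convexHull_range {E : Type*} [AddCommGroup E] [Module ℝ E]
    {ι : Type*} [Fintype ι] {f : ι → E} {z : E} (h : z ∈ convexHull ℝ (Set.range f)) :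
    ∃ w : ι → ℝ, (∀ i, 0 ≤ w i) ∧ ∑ i, w i = 1 ∧ ∑ i, w i • f i = z := by
  classical
  rw [convexHull_range_eq_exists_affineCombination] at h
  obtain ⟨s, w, hw0, hw1, rfl⟩ := h
  rw [s.affineCombination_eq_linear_combination _ _ hw1]
  refine ⟨fun i => if i ∈ s then w i else 0, fun i => ?_, by simpa using hw1, by simp⟩
  dsimp only
  split_ifs with hi
  exacts [hw0 i hi, le_rfl]

theorem measureReal_pi_eq_and_eq {D : Type*} [MeasurableSpace D] (ν : Measure D)
    [IsProbabilityMeasure ν] {k : ℕ} {i j : Fin k} (hij : i ≠ j) (a b : D) :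
    (Measure.pi fun _ : Fin k => ν).real {x | x i = a ∧ x j = b} = ν.real {a} * ν.real {b} := by
  have h := Measure.pi_pi_finset (fun _ : Fin k => ν) (fun l => if l = i then {a} else {b}) {i, j}
  rw [Finset.prod_pair hij, if_pos rfl, if_neg hij.symm] at h
  rw [measureReal_def, measureReal_def, measureReal_def, ← ENNReal.toReal_mul, ← h]
  congr 2
  ext x
  simp [Set.pi, hij.symm]

/-- The index set of the events `x i = a ∧ x j = b` with `i ≠ j`. -/
abbrev PairIndex (D : Type*) (k : ℕ) : Type _ :=
  {t : Fin k × Fin k // t.1 ≠ t.2} × D × D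

theorem finrank_pairFeature_le (D : Type*) [Fintype D] (k : ℕ) :
    Module.finrank ℝ (EuclideanSpace ℝ (PairIndex D k)) ≤ k ^ 2 * Fintype.card D ^ 2 := by
  rw [finrank_euclideanSpace, Fintype.card_prod, Fintype.card_prod, sq, sq]
  gcongr
  exact (Fintype.card_subtype_le _).trans (by simp)

section PairFeature

variable {D : Type*} [Fintype D] [DecidableEq D] [MeasurableSpace D] [MeasurableSingletonClass D]

/-- The vector of the centered indicators of the events `x i = a ∧ x j = b`, for `i ≠ j`. A
distribution on `D ^ k` is pairwise `ν`-independent exactly when this vector has mean zero. -/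
noncomputable def pairFeature (ν : Measure D) {k : ℕ} (x : Fin k → D) :
    EuclideanSpace ℝ (PairIndex D k) :=
  WithLp.toLp 2 fun t => (if x t.1.1.1 = t.2.1 ∧ x t.1.1.2 = t.2.2 then 1 else 0) -
    ν.real {t.2.1} * ν.real {t.2.2}

theorem supportsTWiseIndependent_two_of_zero_mem_convexHull (ν : Measure D)
    [IsProbabilityMeasure ν] {k : ℕ} {ι : Type*} [Fintype ι] (x : ι → Fin k → D)
    (h : 0 ∈ convexHull ℝ (Set.range fun l => pairFeature ν (x l))) :
    SupportsTWiseIndependent 2 ν (Set.range x) := by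
  obtain ⟨w, hw0, hw1, hw⟩ := exists_weights_of_mem_convexHull_range h
  refine ⟨∑ l, ENNReal.ofReal (w l) • Measure.dirac (x l), ⟨?_⟩, fun T hT => ?_, fun a ha => ?_⟩
  · simp only [Measure.coe_finsetSum, Finset.sum_apply, Measure.smul_apply, measure_univ,
      smul_eq_mul, mul_one]
    rw [← ENNReal.ofReal_sum_of_nonneg fun l _ => hw0 l, hw1, ENNReal.ofReal_one]
  · obtain ⟨i, j, hij, rfl⟩ := Finset.card_eq_two.1 hT
    refine Measure.ext_of_singleton fun g => ?_
    -- Extend the partial assignment `g` to all coordinates.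
    obtain ⟨G, rfl⟩ : ∃ G : Fin k → D, Finset.restrict {i, j} G = g := by
      refine ⟨fun l => if h : l ∈ ({i, j} : Finset (Fin k)) then g ⟨l, h⟩ else g ⟨i, by simp⟩, ?_⟩
      ext l
      have := l.2
      simp [-Finset.mem_insert, this]
    have hsum := congrArg
      (fun u : EuclideanSpace ℝ (PairIndex D k) => u (⟨(i, j), hij⟩, G i, G j)) hw
    simp only [pairFeature, WithLp.ofLp_sum, WithLp.ofLp_smul, Finset.sum_apply, Pi.smul_apply,
      smul_eq_mul, mul_sub, Finset.sum_sub_distrib, ← Finset.sum_mul, hw1, one_mul,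
      WithLp.ofLp_zero, Pi.zero_apply, sub_eq_zero] at hsum
    rw [Measure.map_apply (Finset.measurable_restrict _) (measurableSet_singleton _),
      Measure.pi_singleton]
    have hprod : ∏ l : ({i, j} : Finset (Fin k)), ν {Finset.restrict {i, j} G l} =
        ν {G i} * ν {G j} := by
      rw [← Finset.prod_pair (f := fun l => ν {G l}) hij]
      exact Finset.prod_coe_sort {i, j} fun l => ν {G l}
    rw [hprod, ← ofReal_measureReal (s := {G i}), ← ofReal_measureReal (s := {G j}),
      ← ENNReal.ofReal_mul measureReal_nonneg, ← hsum, ENNReal.ofReal_sum_of_nonneg]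
    · simp only [Measure.coe_finsetSum, Finset.sum_apply, Measure.smul_apply, smul_eq_mul]
      refine Finset.sum_congr rfl fun l _ => ?_
      rw [ENNReal.ofReal_mul (hw0 l), Measure.dirac_apply' _ (Set.toFinite _).measurableSet]
      congr 1
      have : Finset.restrict (π := fun _ => D) {i, j} (x l) = Finset.restrict {i, j} G ↔
          x l i = G i ∧ x l j = G j := by
        simp [funext_iff, Finset.restrict]
      simp only [Set.indicator, Set.mem_preimage, Set.mem_singleton_iff, this, Pi.one_apply]
      split_ifs <;> simp
    · intro l _
      have := hw0 l
      positivity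
  · by_contra hx
    refine ha ?_
    simp only [Measure.coe_finsetSum, Finset.sum_apply, Measure.smul_apply, smul_eq_mul]
    refine Finset.sum_eq_zero fun l _ => ?_
    rw [Measure.dirac_apply' _ (measurableSet_singleton _), Set.indicator_of_notMem, mul_zero]
    rintro rfl
    exact hx (Set.mem_range_self l)

theorem integral_inner_pairFeature (ν : Measure D) [IsProbabilityMeasure ν] {k : ℕ}
    (w : EuclideanSpace ℝ (PairIndex D k)) :
    ∫ x, inner ℝ w (pairFeature ν x) ∂Measure.pi (fun _ => ν) = 0 := by
  simp only [PiLp.inner_apply, pairFeature]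
  rw [integral_finsetSum _ fun _ _ => .of_finite]
  refine Finset.sum_eq_zero fun t _ => ?_
  have h : ∫ x : Fin k → D, (if x t.1.1.1 = t.2.1 ∧ x t.1.1.2 = t.2.2 then 1 else 0 : ℝ)
      ∂Measure.pi (fun _ => ν) = ν.real {t.2.1} * ν.real {t.2.2} := by
    rw [← measureReal_pi_eq_and_eq ν t.1.2,
      ← integral_indicator_one (Set.toFinite _).measurableSet]
    refine integral_congr_ae (.of_forall fun x => ?_)
    simp [Set.indicator]
  simp only [RCLike.inner_apply, conj_trivial]
  rw [integral_mul_const, integral_sub .of_finite .of_finite, h]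
  simp

end PairFeature

theorem hasDegreeLT_inner_pairFeature (p : unitInterval) {k : ℕ}
    (w : EuclideanSpace ℝ (PairIndex (Fin 2) k)) :
    HasDegreeLT k 3 (fun x => inner ℝ w (pairFeature (biased p) x)) := by
  have h : (fun x => inner ℝ w (pairFeature (biased p) x)) = ∑ t : PairIndex (Fin 2) k,
      fun x => w t * ((if x t.1.1.1 = t.2.1 ∧ x t.1.1.2 = t.2.2 then 1 else 0) -
        (biased p).real {t.2.1} * (biased p).real {t.2.2}) := by
    ext x
    simp [PiLp.inner_apply, pairFeature, mul_comm]
  rw [h]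
  refine .sum _ fun t _ => .const_mul _ ?_
  exact .of_apply_apply (fun a b => (if a = t.2.1 ∧ b = t.2.2 then 1 else 0) -
    (biased p).real {t.2.1} * (biased p).real {t.2.2}) _ _

/-- Every homogeneous half-space of the feature space has probability bounded below, uniformly in
the dimension. -/
theorem exists_le_measureReal_inner_pairFeature_nonpos (p : unitInterval) (hp0 : 0 < (p : ℝ))
    (hp1 : (p : ℝ) < 1) : ∃ c : ℝ, 0 < c ∧ ∀ (k : ℕ) (w : EuclideanSpace ℝ (PairIndex (Fin 2) k)),
      c ≤ (Measure.pi fun _ : Fin k => biased p).real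
        {x | inner ℝ w (pairFeature (biased p) x) ≤ 0} := by
  have hσ0 : 0 < (p : ℝ) * (1 - p) := mul_pos hp0 (by linarith)
  have hσ1 : (p : ℝ) * (1 - p) ≤ 1 := by nlinarith
  set σ : ℝ := p * (1 - p)
  set L : ℝ := 4 / σ
  have hL : 4 ≤ L := by rw [le_div_iff₀ hσ0]; linarith
  have hLσ : 3 ≤ L ^ 2 * σ := by
    have : L * σ = 4 := div_mul_cancel₀ _ hσ0.ne'
    rw [sq, mul_assoc, this]; linarith
  have hM : 1 ≤ (L ^ 2) ^ 3 := one_le_pow₀ (one_le_pow₀ (by linarith))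
  refine ⟨1 / (4 * (L ^ 2) ^ 3), by positivity, fun k w => ?_⟩
  rw [div_le_iff₀' (by positivity)]
  exact one_le_four_mul_measureReal_nonpos _ hM (integral_inner_pairFeature _ w)
    (integral_pow_four_le p hL hLσ (hasDegreeLT_inner_pairFeature p w))

/-- The random relation fails to support a pairwise `ν_p`-independent distribution with probability
exponentially small in the number of samples, once this is a large multiple of `k ^ 2`. -/
theorem exists_measureReal_not_supportsTWiseIndependent_le (p : unitInterval) (hp0 : 0 < (p : ℝ))
    (hp1 : (p : ℝ) < 1) : ∃ c : ℝ, 0 < c ∧ c ≤ 1 ∧ ∀ k s : ℕ, 0 < k → 0 < s →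
      (randomStrings p k s).real {x | ¬ SupportsTWiseIndependent 2 (biased p) (Set.range x)} ≤
        (2 / c) ^ (5 * k ^ 2) * (1 - c / 2) ^ s := by
  obtain ⟨c, hc0, hc⟩ := exists_le_measureReal_inner_pairFeature_nonpos p hp0 hp1
  refine ⟨c, hc0, (hc 0 0).trans measureReal_le_one, fun k s hk hs => ?_⟩
  have : Nonempty (Fin s) := ⟨⟨0, hs⟩⟩
  have hn : Module.finrank ℝ (EuclideanSpace ℝ (PairIndex (Fin 2) k)) + 1 ≤ 5 * k ^ 2 := by
    have h1 := finrank_pairFeature_le (Fin 2) k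
    have h2 : 0 < k ^ 2 := by positivity
    simp only [Fintype.card_fin] at h1
    omega
  have h := measureReal_zero_notMem_convexHull_le (Measure.pi fun _ : Fin k => biased p)
    (pairFeature (biased p)) hc0 (hc k) (ι := Fin s) hn
  rw [Fintype.card_fin] at h
  refine (measureReal_mono fun x hx => ?_).trans h
  exact mt (supportsTWiseIndependent_two_of_zero_mem_convexHull _ x) hx

/-! ### Strings forced by a pairwise uniform distribution -/

theorem TWiseIndependent.map_eval {D : Type*} [MeasurableSpace D] {ν : Measure D}
    [IsProbabilityMeasure ν] {k : ℕ} (hk : 2 ≤ k) {μ : Measure (Fin k → D)}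
    (h : TWiseIndependent 2 ν μ) (i : Fin k) : μ.map (Function.eval i) = ν := by
  have : Nontrivial (Fin k) := Fin.nontrivial_iff_two_le.2 hk
  obtain ⟨j, hij⟩ := exists_ne i
  have hi : i ∈ ({i, j} : Finset (Fin k)) := by simp
  have h2 := h {i, j} (Finset.card_pair hij.symm)
  have heval := measurePreserving_eval (fun _ : ({i, j} : Finset (Fin k)) => ν) ⟨i, hi⟩
  rw [← heval.map_eq, ← h2, Measure.map_map heval.measurable (Finset.measurable_restrict _)]
  rfl

theorem one_half_le_uniformOn {S : Set (Fin 2)} (h : 1 ∈ S) :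
    1 / 2 ≤ (uniformOn S).real {1} := by
  rcases Set.subsingleton_or_nontrivial S with hS | hS
  · rw [hS.eq_singleton_of_mem h]
    norm_num [measureReal_def, uniformOn_singleton]
  · have : S = Set.univ := by
      ext i
      obtain ⟨j, hj, hj1⟩ := hS.exists_ne 1
      have : j = 0 := by omega
      subst this
      fin_cases i <;> simp_all
    rw [this, measureReal_def, uniformOn_univ]
    simp

/-- If `R` supports a pairwise uniform distribution over some nonempty subdomain of `{0, 1}`, then
`R` contains the zero string (if the subdomain is `{0}`) or a string at least half of whose entries
are `1` (otherwise, as the expected number of ones is then at least `k / 2`). -/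
theorem exists_mem_of_supportsTWiseUniformOn {k : ℕ} (hk : 2 ≤ k) {S : Set (Fin 2)}
    (hS : S.Nonempty) {R : Set (Fin k → Fin 2)} (h : SupportsTWiseUniformOn 2 S R) :
    ∃ a ∈ R, (∀ i, a i = 0) ∨ k ≤ 2 * (Finset.univ.filter fun i => a i = 1).card := by
  obtain ⟨μ, hμ, hind, hsupp⟩ := h
  have hν : IsProbabilityMeasure (uniformOn S) :=
    isProbabilityMeasure_uniformOn S.toFinite hS
  have hnull : μ {a | μ {a} = 0} = 0 := by
    rw [← Set.biUnion_of_singleton {a | μ {a} = 0},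
      measure_biUnion_null_iff (Set.toFinite _).countable]
    exact fun a ha => ha
  obtain ⟨a, ha, hle⟩ := exists_notMem_null_integral_le (μ := μ)
    (f := fun a => ((Finset.univ.filter fun i => a i = 1).card : ℝ)) .of_finite hnull
  obtain ⟨haR, haS⟩ := hsupp a ha
  refine ⟨a, haR, ?_⟩
  by_cases h1 : (1 : Fin 2) ∈ S
  · right
    have hone (i : Fin k) : 1 / 2 ≤ μ.real {a | a i = 1} := by
      refine (one_half_le_uniformOn h1).trans_eq ?_
      rw [← hind.map_eval hk i, measureReal_def, measureReal_def,
        Measure.map_apply (measurable_pi_apply i) (measurableSet_singleton _)]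
      rfl
    have hint : ∫ a, ((Finset.univ.filter fun i => a i = 1).card : ℝ) ∂μ =
        ∑ i, μ.real {a : Fin k → Fin 2 | a i = 1} := by
      simp only [Finset.card_filter, Nat.cast_sum, Nat.cast_ite, Nat.cast_one, Nat.cast_zero]
      rw [integral_finsetSum _ fun _ _ => .of_finite]
      refine Finset.sum_congr rfl fun i _ => ?_
      rw [← integral_indicator_one (Set.toFinite _).measurableSet]
      refine integral_congr_ae (.of_forall fun x => ?_)
      simp [Set.indicator]
    rw [hint] at hle
    have h2 : (k : ℝ) * (1 / 2) ≤ ∑ i, μ.real {a : Fin k → Fin 2 | a i = 1} := by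
      simpa using Finset.card_nsmul_le_sum Finset.univ _ (1 / 2 : ℝ) fun i _ => hone i
    have h3 : (k : ℝ) ≤ 2 * (Finset.univ.filter fun i => a i = 1).card := by linarith
    exact_mod_cast h3
  · left
    intro i
    have := haS i
    by_contra h0
    exact h1 ((show a i = 1 by omega) ▸ this)

theorem measureReal_pi_biased_eq_zero (p : unitInterval) (k : ℕ) :
    (Measure.pi fun _ : Fin k => biased p).real {a | ∀ i, a i = 0} = (1 - p) ^ k := by
  have h : {a : Fin k → Fin 2 | ∀ i, a i = 0} = {0} := by
    ext a
    simp [funext_iff]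
  rw [h, measureReal_def, Measure.pi_singleton, ENNReal.toReal_prod]
  simp only [Pi.zero_apply, Finset.prod_const, Finset.card_univ, Fintype.card_fin]
  congr 1
  exact bernoulliMeasure_real_apply_of_notMem_of_mem p (measurableSet_singleton _) (by simp)
    (by simp)

/-- A Chernoff bound: half of the entries of a biased string are ones with probability at most the
`k`-th power of the exponential moment of a single bit. -/
theorem measureReal_pi_biased_half_le (p : unitInterval) (k : ℕ) :
    (Measure.pi fun _ : Fin k => biased p).real
      {a | k ≤ 2 * (Finset.univ.filter fun i => a i = 1).card} ≤ ((1 + 3 * p) / 2) ^ k := by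
  -- The exponential moment of the difference between the numbers of ones and of zeros, in base `2`.
  set u : Fin 2 → ℝ := fun b => if b = 1 then 2 else 1 / 2 with hu
  have hint : ∫ a : Fin k → Fin 2, ∏ i, u (a i) ∂Measure.pi (fun _ => biased p) =
      ((1 + 3 * p) / 2) ^ k := by
    rw [integral_fintype_prod_eq_pow, Fintype.card_fin, biased, integral_bernoulliMeasure]
    congr 1
    simp [hu]
    ring
  have hu0 (b : Fin 2) : 0 ≤ u b := by
    simp only [hu]
    split_ifs <;> norm_num
  have hmarkov := mul_meas_ge_le_integral_of_nonneg (μ := Measure.pi fun _ : Fin k => biased p)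
    (f := fun a => ∏ i, u (a i)) (.of_forall fun a => Finset.prod_nonneg fun i _ => hu0 _)
    .of_finite 1
  rw [one_mul, hint] at hmarkov
  refine (measureReal_mono fun a ha => ?_).trans hmarkov
  simp only [Set.mem_ofPred_eq, hu, Finset.prod_ite, Finset.prod_const] at ha ⊢
  have hcard := Finset.card_filter_add_card_filter_not (s := Finset.univ) fun i => a i = 1
  rw [Finset.card_univ, Fintype.card_fin] at hcard
  rw [one_div, inv_pow, ← div_eq_mul_inv, one_le_div (by positivity)]
  exact pow_le_pow_right₀ (by norm_num) (by omega)

theorem measureReal_randomStrings_exists_le (p : unitInterval) (k s : ℕ)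
    (B : Set (Fin k → Fin 2)) :
    (randomStrings p k s).real {x | ∃ l, x l ∈ B} ≤
      s * (Measure.pi fun _ : Fin k => biased p).real B := by
  have h : {x : Fin s → Fin k → Fin 2 | ∃ l, x l ∈ B} = ⋃ l, Function.eval l ⁻¹' B := by
    ext x
    simp
  rw [h]
  refine (measureReal_iUnion_fintype_le _).trans_eq ?_
  have heval (l : Fin s) : (randomStrings p k s).real (Function.eval l ⁻¹' B) =
      (Measure.pi fun _ : Fin k => biased p).real B :=
    (measurePreserving_eval (fun _ : Fin s => Measure.pi fun _ : Fin k => biased p)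
      l).measureReal_preimage (Set.toFinite _).measurableSet.nullMeasurableSet
  simp [heval]

theorem measureReal_exists_supportsTWiseUniformOn_le (p : unitInterval) {k : ℕ} (hk : 2 ≤ k)
    (s : ℕ) : (randomStrings p k s).real
      {x | ∀ S : Set (Fin 2), S.Nonempty → ¬ SupportsTWiseUniformOn 2 S (Set.range x)}ᶜ ≤
      s * (1 - p) ^ k + s * ((1 + 3 * p) / 2) ^ k := by
  have h1 := measureReal_randomStrings_exists_le p k s {a | ∀ i, a i = 0}
  have h2 := measureReal_randomStrings_exists_le p k s
    {a | k ≤ 2 * (Finset.univ.filter fun i => a i = 1).card}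
  rw [measureReal_pi_biased_eq_zero] at h1
  have h3 := mul_le_mul_of_nonneg_left (measureReal_pi_biased_half_le p k) (Nat.cast_nonneg s)
  refine (measureReal_mono fun x hx => ?_).trans
    ((measureReal_union_le _ _).trans (add_le_add h1 (h2.trans h3)))
  simp only [Set.mem_compl_iff, Set.mem_ofPred_eq, not_forall, not_not] at hx
  obtain ⟨S, hS, h⟩ := hx
  obtain ⟨_, ⟨l, rfl⟩, ha⟩ := exists_mem_of_supportsTWiseUniformOn hk hS h
  exact ha.imp (fun h => ⟨l, h⟩) fun h => ⟨l, h⟩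

/-! ### Asymptotics -/

theorem tendsto_mul_pow_of_isBigO_sq {s : ℕ → ℕ}
    (hs : (fun k => (s k : ℝ)) =O[atTop] (fun k : ℕ => (k : ℝ) ^ 2)) {r : ℝ} (hr0 : 0 ≤ r)
    (hr1 : r < 1) : Tendsto (fun k => (s k : ℝ) * r ^ k) atTop (𝓝 0) :=
  (hs.mul (isBigO_refl (fun k : ℕ => r ^ k) atTop)).trans_tendsto
    (tendsto_pow_const_mul_const_pow_of_lt_one 2 hr0 hr1)

theorem tendsto_measureReal_one_of_compl_le {Ω : ℕ → Type*} [∀ k, MeasurableSpace (Ω k)]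
    {μ : ∀ k, Measure (Ω k)} [∀ k, IsProbabilityMeasure (μ k)] {A : ∀ k, Set (Ω k)}
    (hA : ∀ k, MeasurableSet (A k)) {ε : ℕ → ℝ} (hε : Tendsto ε atTop (𝓝 0))
    (h : ∀ᶠ k in atTop, (μ k).real (A k)ᶜ ≤ ε k) :
    Tendsto (fun k => (μ k).real (A k)) atTop (𝓝 1) := by
  have h1 : Tendsto (fun k => 1 - ε k) atTop (𝓝 1) := by simpa using hε.const_sub 1
  refine tendsto_of_tendsto_of_tendsto_of_le_of_le' h1 tendsto_const_nhds ?_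
    (.of_forall fun k => measureReal_le_one)
  filter_upwards [h] with k hk
  rw [probReal_compl_eq_one_sub (hA k)] at hk
  linarith

theorem mainTheorem10 (p : unitInterval) (hp0 : 0 < (p : ℝ)) (hp1 : (p : ℝ) < 1 / 16) :
    ∃ C : ℝ, 0 < C ∧ ∀ s : ℕ → ℕ,
      (fun k => (s k : ℝ)) =Θ[atTop] (fun k : ℕ => (k : ℝ) ^ 2) →
        ((∀ᶠ k : ℕ in atTop, C * (k : ℝ) ^ 2 ≤ (s k : ℝ)) →
          Tendsto (fun k : ℕ => (randomStrings p k (s k)).real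
            {x | SupportsTWiseIndependent 2 (biased p) (Set.range x) ∧
              ∀ S : Set (Fin 2), S.Nonempty → ¬ SupportsTWiseUniformOn 2 S (Set.range x)})
            atTop (𝓝 1)) ∧
        Tendsto (fun k : ℕ => (randomStrings p k (s k)).real
          {x | ∀ S : Set (Fin 2), S.Nonempty → ¬ SupportsTWiseUniformOn 2 S (Set.range x)})
          atTop (𝓝 1) := by
  obtain ⟨c, hc0, hc1, hc⟩ :=
    exists_measureReal_not_supportsTWiseIndependent_le p hp0 (by linarith)
  -- `N` samples per pair of coordinates outweigh the entropy factor `(2 / c) ^ 5`.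
  obtain ⟨N, hN⟩ := exists_pow_lt_of_lt_one (y := 1 - c / 2)
    (show 0 < 1 / (2 * (2 / c) ^ 5) by positivity) (by linarith)
  have hρ0 : 0 ≤ 1 - c / 2 := by linarith
  have hN' : (2 / c) ^ 5 * (1 - c / 2) ^ N ≤ 1 / 2 := by
    rw [lt_div_iff₀ (by positivity)] at hN
    linarith
  refine ⟨N + 1, by positivity, fun s hs => ?_⟩
  set ε : ℕ → ℝ := fun k => s k * (1 - p) ^ k + s k * ((1 + 3 * p) / 2) ^ k with hε
  have hε0 : Tendsto ε atTop (𝓝 0) := by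
    simpa using (tendsto_mul_pow_of_isBigO_sq hs.1 (r := 1 - p) (by linarith) (by linarith)).add
      (tendsto_mul_pow_of_isBigO_sq hs.1 (r := (1 + 3 * p) / 2) (by linarith) (by linarith))
  have huniform : ∀ᶠ k in atTop, (randomStrings p k (s k)).real
      {x | ∀ S : Set (Fin 2), S.Nonempty → ¬ SupportsTWiseUniformOn 2 S (Set.range x)}ᶜ ≤ ε k := by
    filter_upwards [eventually_ge_atTop 2] with k hk
    exact measureReal_exists_supportsTWiseUniformOn_le p hk (s k)
  refine ⟨fun hsC => ?_, tendsto_measureReal_one_of_compl_le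
    (fun k => (Set.toFinite _).measurableSet) hε0 huniform⟩
  refine tendsto_measureReal_one_of_compl_le (fun k => (Set.toFinite _).measurableSet)
    (ε := fun k => (1 / 2) ^ k + ε k) ?_ ?_
  · simpa using (tendsto_pow_atTop_nhds_zero_of_lt_one (r := (1 / 2 : ℝ)) (by norm_num)
      (by norm_num)).add hε0
  filter_upwards [huniform, hsC, eventually_gt_atTop 0] with k hk hsk hk0
  have hNs : N * k ^ 2 + k ^ 2 ≤ s k := by
    have : ((N * k ^ 2 + k ^ 2 : ℕ) : ℝ) ≤ s k := by
      push_cast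
      linarith
    exact_mod_cast this
  have hk2 : k ≤ k ^ 2 := Nat.le_self_pow two_ne_zero k
  have hind : (randomStrings p k (s k)).real
      {x | ¬ SupportsTWiseIndependent 2 (biased p) (Set.range x)} ≤ (1 / 2) ^ k := calc
    _ ≤ (2 / c) ^ (5 * k ^ 2) * (1 - c / 2) ^ s k := hc k (s k) hk0 (by omega)
    _ ≤ (2 / c) ^ (5 * k ^ 2) * (1 - c / 2) ^ (N * k ^ 2) := by
      gcongr ?_ * ?_
      exact pow_le_pow_of_le_one hρ0 (by linarith) (by omega)
    _ = ((2 / c) ^ 5 * (1 - c / 2) ^ N) ^ (k ^ 2) := by rw [pow_mul, pow_mul, mul_pow]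
    _ ≤ (1 / 2) ^ (k ^ 2) := by gcongr
    _ ≤ (1 / 2) ^ k := pow_le_pow_of_le_one (by norm_num) (by norm_num) hk2
  refine le_trans ?_ (add_le_add hind hk)
  refine (measureReal_mono fun x hx => ?_).trans (measureReal_union_le _ _)
  rwa [Set.mem_compl_iff, Set.mem_ofPred_eq, not_and_or] at hx
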